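/- Let $K$ be a field. By an operad we mean a symmetric operad in the category of $K$-vector spaces. For a vector space $V$ let $\mathrm{End}_V(n)=\mathrm{Hom}_K(V^{\otimes n},V)$ and $\mathrm{CoEnd}_V(n)=\mathrm{Hom}_K(V,V^{\otimes n})$ be its endomorphism and coendomorphism operads. An algebra (resp. coalgebra) over an operad $P$ is a vector space $V$ with a morphism of operads $P\to\mathrm{End}_V$ (resp. $P\to\mathrm{CoEnd}_V$). Morphisms of $P$-coalgebras are the linear maps $f$ such that $f^{\otimes n}\circ p_V=p_W\circ f$ for all $n$ and all $p\in P(n)$. Let $\mathsf{Ins}$ be the operad presented by the following generators and relations. The generators are an operation $\mu$ of arity $2$, operations $\upsilon_n$ of arity $0$ for $n\ge 0$, and an operation $I_\lambda$ of arity $1$ for every nonzero finitely supported sequence $\lambda=(\lambda_n)_{n\ge0}$ of elements of $K$. The relations are those of the unital associative operad for $(\mu,\upsilon_0)$, that is $\mu\circ(\mu\otimes\mathrm{id})=\mu\circ(\mathrm{id}\otimes\mu)$ and $\mu\circ(\upsilon_0\otimes\mathrm{id})=\mathrm{id}=\mu\circ(\mathrm{id}\otimes\upsilon_0)$, together with $$\mu\circ\Bigl(\sum_{n}\lambda_n\upsilon_n\otimes\mathrm{id}\Bigr)\circ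 I_\lambda=\mathrm{id}\qquad\text{for all }\lambda\ne0.$$ Then the following hold. 1. For every vector space $V$, the $\mathsf{Ins}$-algebra structures on $V$ are exactly the systems $(\mu,\upsilon_n,I_\lambda)$ consisting of a bilinear map $\mu:V\times V\to V$, elements $\upsilon_n\in V$ $(n\ge0)$ and linear maps $I_\lambda:V\to V$, such that $(V,\mu,\upsilon_0)$ is a unital associative algebra and $\mu(\sum_n\lambda_n\upsilon_n,I_\lambda(x))=x$ for all $\lambda\neq 0$ and all $x\in V$. 2. Let $L/K$ be a field extension of infinite degree. There are sequences $\upsilon_0=1,\upsilon_1,\upsilon_2,\dots$ in $L$ that are linearly independent over $K$. For each such sequence, $\sum_n\lambda_n\upsilon_n\ne0$ for all $\lambda\ne0$, and there is exactly one $\mathsf{Ins}$-algebra structure on $L$ in which $\mu$ is the multiplication of $L$, the constants are the $\upsilon_n$, and $I_\lambda$ is multiplication by $(\sum_n\lambda_n\upsilon_n)^{-1}$. In particular $L$ is a nonzero $\mathsf{Ins}$-algebra. 3. The operad $\mathsf{Ins}$ is not trivial: $\mathsf{Ins}(n)\neq0$ for some $n$. 4. Every $\mathsf{Ins}$-coalgebra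 is zero. 5. The forgetful functor from $\mathsf{Ins}$-coalgebras to vector spaces has a right adjoint (cofree $\mathsf{Ins}$-coalgebras exist), and for every such adjunction the induced comonad on the category of vector spaces is zero, that is, its underlying functor is a zero object in the category of endofunctors. -/

import Mathlib

open CategoryTheory

/-! ### Relabelings of inputs attached to blocks -/

namespace Block

/-- The identification of the inputs of `q` with those of `id ∘ q`. -/
def unitLeft (k : ℕ) : Fin k ≃ Fin (∑ _i : Fin 1, k) :=
  (Equiv.uniqueSigma (fun _ : Fin 1 => Fin k)).symm.trans finSigmaFinEquiv

/-- The identification of the inputs of `p` with those of `p ∘ (id, …, id)`. -/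
def unitRight (n : ℕ) : Fin n ≃ Fin (∑ _i : Fin n, 1) :=
  (Equiv.sigmaUnique (Fin n) (fun _ => Fin 1)).symm.trans finSigmaFinEquiv

/-- The permutation of the blocks of sizes `k (σ 0), k (σ 1), …` induced by `σ`: the `i`-th block
of the source becomes the `σ i`-th block of the target. -/
def outer {m n : ℕ} (σ : Fin m ≃ Fin n) (k : Fin n → ℕ) :
    Fin (∑ i, k (σ i)) ≃ Fin (∑ j, k j) :=
  finSigmaFinEquiv.symm.trans
    ((Equiv.sigmaCongrLeft (β := fun j => Fin (k j)) σ).trans finSigmaFinEquiv)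

/-- The sum `τ 0 ⊕ τ 1 ⊕ …` of relabelings, the `i`-th one acting inside the `i`-th block. -/
def inner {n : ℕ} {k l : Fin n → ℕ} (τ : ∀ i, Fin (k i) ≃ Fin (l i)) :
    Fin (∑ i, k i) ≃ Fin (∑ i, l i) :=
  finSigmaFinEquiv.symm.trans ((Equiv.sigmaCongrRight τ).trans finSigmaFinEquiv)

/-- The index of the block, and the position in it, of an element of a sum of blocks. -/
abbrev pos {n : ℕ} (k : Fin n → ℕ) (x : Fin (∑ i, k i)) : Σ i, Fin (k i) :=
  finSigmaFinEquiv.symm x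

/-- The identification of the inputs of `(p ∘ q) ∘ r` with those of `p ∘ (q ∘ r)`. -/
def assoc {n : ℕ} (k : Fin n → ℕ) (l : ∀ i, Fin (k i) → ℕ) :
    Fin (∑ x : Fin (∑ i, k i), l (pos k x).1 (pos k x).2) ≃ Fin (∑ i, ∑ j, l i j) :=
  finSigmaFinEquiv.symm.trans <|
    (Equiv.sigmaCongrLeft (β := fun y : Σ i, Fin (k i) => Fin (l y.1 y.2))
      finSigmaFinEquiv.symm).trans <|
    (Equiv.sigmaAssoc (fun i j => Fin (l i j))).trans <|
    (Equiv.sigmaCongrRight fun _ => finSigmaFinEquiv).trans finSigmaFinEquiv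

theorem pos_apply {n : ℕ} (k : Fin n → ℕ) (y : Σ i, Fin (k i)) :
    pos k (finSigmaFinEquiv y) = y :=
  finSigmaFinEquiv.symm_apply_apply y

theorem outer_apply {m n : ℕ} (σ : Fin m ≃ Fin n) (k : Fin n → ℕ) (i : Fin m)
    (j : Fin (k (σ i))) :
    outer σ k (finSigmaFinEquiv ⟨i, j⟩) = finSigmaFinEquiv ⟨σ i, j⟩ := by
  simp [outer, Equiv.sigmaCongrLeft]

theorem inner_apply {n : ℕ} {k l : Fin n → ℕ} (τ : ∀ i, Fin (k i) ≃ Fin (l i)) (i : Fin n)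
    (j : Fin (k i)) :
    inner τ (finSigmaFinEquiv ⟨i, j⟩) = finSigmaFinEquiv ⟨i, τ i j⟩ := by
  simp [inner]

theorem assoc_apply {n : ℕ} (k : Fin n → ℕ) (l : ∀ i, Fin (k i) → ℕ) (z : Fin (∑ i, k i))
    (m : Fin (l (pos k z).1 (pos k z).2)) :
    assoc k l (finSigmaFinEquiv ⟨z, m⟩) =
      finSigmaFinEquiv ⟨(pos k z).1, finSigmaFinEquiv ⟨(pos k z).2, m⟩⟩ := by
  simp only [assoc, Equiv.trans_apply]
  rw [Equiv.symm_apply_apply]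
  rfl

end Block

universe u v w x

/-! ### Linear operads -/

/-- A (symmetric) operad in the category of `K`-vector spaces. The space of operations of arity `n`
is `obj n`. The symmetric group actions are given in the form of a relabeling map for each
bijection `Fin m ≃ Fin n` (which forces `m = n`); for `m = n` this is the left action of the
symmetric group, i.e. `p · σ = perm σ⁻¹ p`, and the input numbered `i` of `p` becomes the
input numbered `σ i` of `perm σ p`. The composition `comp k p q` is `p ∘ (q 0, …, q (n - 1))`. -/
structure LinOperad (K : Type u) [Field K] where
  obj : ℕ → Type v
  [addCommGroup : ∀ n, AddCommGroup (obj n)]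
  [module : ∀ n, Module K (obj n)]
  perm : ∀ {m n : ℕ}, (Fin m ≃ Fin n) → obj m →ₗ[K] obj n
  one : obj 1
  comp : ∀ {n : ℕ} (k : Fin n → ℕ),
    obj n →ₗ[K] MultilinearMap K (fun i => obj (k i)) (obj (∑ i, k i))
  perm_refl : ∀ {n : ℕ} (p : obj n), perm (Equiv.refl (Fin n)) p = p
  perm_trans : ∀ {l m n : ℕ} (σ : Fin l ≃ Fin m) (τ : Fin m ≃ Fin n) (p : obj l),
    perm (σ.trans τ) p = perm τ (perm σ p)
  one_comp : ∀ {k : ℕ} (q : obj k),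
    comp (fun _ : Fin 1 => k) one (fun _ => q) = perm (Block.unitLeft k) q
  comp_one : ∀ {n : ℕ} (p : obj n),
    comp (fun _ : Fin n => 1) p (fun _ => one) = perm (Block.unitRight n) p
  comp_assoc : ∀ {n : ℕ} (k : Fin n → ℕ) (l : ∀ i, Fin (k i) → ℕ)
    (p : obj n) (q : ∀ i, obj (k i)) (r : ∀ i j, obj (l i j)),
    comp (fun i => ∑ j, l i j) p (fun i => comp (l i) (q i) (r i)) =
      perm (Block.assoc k l)
        (comp (fun z => l (Block.pos k z).1 (Block.pos k z).2) (comp k p q)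
          (fun z => r (Block.pos k z).1 (Block.pos k z).2))
  comp_perm_left : ∀ {m n : ℕ} (σ : Fin m ≃ Fin n) (k : Fin n → ℕ)
    (p : obj m) (q : ∀ j, obj (k j)),
    comp k (perm σ p) q = perm (Block.outer σ k) (comp (fun i => k (σ i)) p (fun i => q (σ i)))
  comp_perm_right : ∀ {n : ℕ} {k l : Fin n → ℕ} (τ : ∀ i, Fin (k i) ≃ Fin (l i))
    (p : obj n) (q : ∀ i, obj (k i)),
    comp l p (fun i => perm (τ i) (q i)) = perm (Block.inner τ) (comp k p q)

namespace LinOperad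

attribute [instance] LinOperad.addCommGroup LinOperad.module

variable {K : Type u} [Field K]

/-- The zero operad (all spaces of operations vanish). -/
def IsTrivial (P : LinOperad.{u, v} K) : Prop :=
  ∀ n, Subsingleton (P.obj n)

/-- Morphisms of operads. -/
@[ext]
structure Hom (P : LinOperad.{u, v} K) (Q : LinOperad.{u, w} K) where
  app : ∀ n, P.obj n →ₗ[K] Q.obj n
  map_perm : ∀ {m n : ℕ} (σ : Fin m ≃ Fin n) (p : P.obj m),
    app n (P.perm σ p) = Q.perm σ (app m p)
  map_one : app 1 P.one = Q.one
  map_comp : ∀ {n : ℕ} (k : Fin n → ℕ) (p : P.obj n) (q : ∀ i, P.obj (k i)),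
    app (∑ i, k i) (P.comp k p q) = Q.comp k (app n p) (fun i => app (k i) (q i))

/-! ### The endomorphism operad -/

section End

variable (K) (V : Type w) [AddCommGroup V] [Module K V]

/-- Composition in the endomorphism operad:
`(f ∘ (g 0, g 1, …)) (v) = f (g 0 (first block of v), g 1 (second block of v), …)`. -/
noncomputable def endComp {n : ℕ} (k : Fin n → ℕ) :
    MultilinearMap K (fun _ : Fin n => V) V →ₗ[K]
      MultilinearMap K (fun i => MultilinearMap K (fun _ : Fin (k i) => V) V)
        (MultilinearMap K (fun _ : Fin (∑ i, k i) => V) V) where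
  toFun f :=
    { toFun := fun g => (f.compMultilinearMap g).domDomCongr finSigmaFinEquiv
      map_update_add' := by
        intro hdec g i a b
        ext v
        have key : ∀ c : MultilinearMap K (fun _ : Fin (k i) => V) V,
            f (fun j => (Function.update g i c j) (fun y => v (finSigmaFinEquiv ⟨j, y⟩)))
              = f (Function.update (fun j => (g j) (fun y => v (finSigmaFinEquiv ⟨j, y⟩)))
                i (c (fun y => v (finSigmaFinEquiv ⟨i, y⟩)))) := by
          intro c
          congr 1
          funext j
          by_cases h : j = i
          · subst h; simp
          · simp [h]
        refine (key _).trans ?_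
        rw [add_apply, MultilinearMap.map_update_add]
        exact (congrArg₂ (· + ·) (key a) (key b)).symm
      map_update_smul' := by
        intro hdec g i a b
        ext v
        have key : ∀ c : MultilinearMap K (fun _ : Fin (k i) => V) V,
            f (fun j => (Function.update g i c j) (fun y => v (finSigmaFinEquiv ⟨j, y⟩)))
              = f (Function.update (fun j => (g j) (fun y => v (finSigmaFinEquiv ⟨j, y⟩)))
                i (c (fun y => v (finSigmaFinEquiv ⟨i, y⟩)))) := by
          intro c
          congr 1
          funext j
          by_cases h : j = i
          · subst h; simp
          · simp [h]
        refine (key _).trans ?_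
        rw [smul_apply, MultilinearMap.map_update_smul]
        exact (congrArg (a • ·) (key b)).symm }
  map_add' f g := by ext; rfl
  map_smul' c f := by ext; rfl

theorem endComp_apply {n : ℕ} (k : Fin n → ℕ) (f : MultilinearMap K (fun _ : Fin n => V) V)
    (g : ∀ i, MultilinearMap K (fun _ : Fin (k i) => V) V) (v : Fin (∑ i, k i) → V) :
    endComp K V k f g v = f (fun i => g i (fun j => v (finSigmaFinEquiv ⟨i, j⟩))) :=
  rfl

/-- The endomorphism operad of `V`; its operations of arity `n` are the linear maps
`V ⊗ … ⊗ V → V`, in the form of multilinear maps. -/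
noncomputable def endOperad : LinOperad.{u, w} K where
  obj n := MultilinearMap K (fun _ : Fin n => V) V
  perm σ := (MultilinearMap.domDomCongrLinearEquiv K K V V σ).toLinearMap
  one := MultilinearMap.ofSubsingleton K V V (0 : Fin 1) LinearMap.id
  comp k := endComp K V k
  perm_refl p := rfl
  perm_trans σ τ p := rfl
  one_comp {k} q := by
    ext v
    rfl
  comp_one {n} p := by
    ext v
    rfl
  comp_assoc k l p q r := by
    ext v
    refine congrArg p (funext fun i => congrArg (q i) (funext fun j => ?_))
    have h := congrArg (fun y : Σ i, Fin (k i) => r y.1 y.2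
      (fun m => v (finSigmaFinEquiv ⟨y.1, finSigmaFinEquiv ⟨y.2, m⟩⟩))) (Block.pos_apply k ⟨i, j⟩)
    refine h.symm.trans (congrArg (r _ _) (funext fun m => ?_))
    exact congrArg v (Block.assoc_apply k l _ m).symm
  comp_perm_left σ k p q := by
    ext v
    exact congrArg p (funext fun i => congrArg (q (σ i))
      (funext fun j => congrArg v (Block.outer_apply σ k i j).symm))
  comp_perm_right τ p q := by
    ext v
    exact congrArg p (funext fun i => congrArg (q i)
      (funext fun j => congrArg v (Block.inner_apply τ i j).symm))

end End

/-! ### The coendomorphism operad -/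

section CoEnd

open PiTensorProduct

variable (K) (V : Type w) [AddCommGroup V] [Module K V]

/-- The `n`-th tensor power of `V`. -/
abbrev Pow (n : ℕ) : Type (max u w) := PiTensorProduct K (fun _ : Fin n => V)

/-- Splitting off the first block. -/
def blockSucc {n : ℕ} (k : Fin (n + 1) → ℕ) :
    (Σ i, Fin (k i)) ≃ Fin (k 0) ⊕ (Σ i : Fin n, Fin (k i.succ)) where
  toFun y := Fin.cases (motive := fun i => Fin (k i) → Fin (k 0) ⊕ (Σ i : Fin n, Fin (k i.succ)))
    (fun j => Sum.inl j) (fun i j => Sum.inr ⟨i, j⟩) y.1 y.2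
  invFun := Sum.elim (fun j => ⟨0, j⟩) (fun y => ⟨y.1.succ, y.2⟩)
  left_inv := by
    rintro ⟨i, j⟩
    induction i using Fin.cases <;> rfl
  right_inv := by rintro (j | ⟨i, j⟩) <;> rfl

/-- A multilinear map in blocks of variables, the `i`-th block being of size `k i`, extends to
a multilinear map whose `i`-th variable ranges over the `k i`-th tensor power. -/
noncomputable def blockLift (E : Type x) [AddCommGroup E] [Module K E] :
    ∀ {n : ℕ} (k : Fin n → ℕ), MultilinearMap K (fun _ : (Σ i, Fin (k i)) => V) E →ₗ[K]
      MultilinearMap K (fun i => Pow K V (k i)) E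
  | 0, k =>
    { toFun := fun F => MultilinearMap.constOfIsEmpty K _ (F (fun y => y.1.elim0))
      map_add' := fun F G => by ext; rfl
      map_smul' := fun c F => by ext; rfl }
  | n + 1, k =>
    { toFun := fun F => LinearMap.uncurryLeft (M := fun i => Pow K V (k i))
        (blockLift E (fun i : Fin n => k i.succ) ∘ₗ
          lift (MultilinearMap.currySum
            (N := fun _ : Fin (k 0) ⊕ (Σ i : Fin n, Fin (k i.succ)) => V)
            (F.domDomCongr (blockSucc k))))
      map_add' := fun F G => by
        have h : (F + G).domDomCongr (blockSucc k) =
          F.domDomCongr (blockSucc k) + G.domDomCongr (blockSucc k) := rfl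
        ext m
        simp [h]
      map_smul' := fun c F => by
        have h : (c • F).domDomCongr (blockSucc k) = c • F.domDomCongr (blockSucc k) := rfl
        ext m
        simp [h] }

theorem blockLift_tprod (E : Type x) [AddCommGroup E] [Module K E] :
    ∀ {n : ℕ} (k : Fin n → ℕ) (F : MultilinearMap K (fun _ : (Σ i, Fin (k i)) => V) E)
      (v : ∀ i, Fin (k i) → V),
      blockLift K V E k F (fun i => tprod K (v i)) = F (fun y => v y.1 y.2)
  | 0, k, F, v => by
    refine congrArg F (funext fun y => y.1.elim0)
  | n + 1, k, F, v => by
    have h := blockLift_tprod E (fun i : Fin n => k i.succ)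
      (MultilinearMap.currySum (N := fun _ : Fin (k 0) ⊕ (Σ i : Fin n, Fin (k i.succ)) => V)
            (F.domDomCongr (blockSucc k)) (v 0)) (fun i => v i.succ)
    simp only [blockLift, LinearMap.coe_mk, AddHom.coe_mk, LinearMap.uncurryLeft_apply,
      LinearMap.comp_apply, lift.tprod]
    refine h.trans (congrArg F (funext fun y => ?_))
    obtain ⟨i, j⟩ := y
    induction i using Fin.cases <;> rfl

/-- The canonical (concatenation) isomorphism `V^{⊗ k 0} ⊗ V^{⊗ k 1} ⊗ … → V^{⊗ (k 0 + k 1 + …)}`. -/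
noncomputable def concat {n : ℕ} (k : Fin n → ℕ) :
    PiTensorProduct K (fun i => Pow K V (k i)) →ₗ[K] Pow K V (∑ i, k i) :=
  lift (blockLift K V _ k ((PiTensorProduct.tprod K).domDomCongr finSigmaFinEquiv.symm))

theorem concat_tprod {n : ℕ} (k : Fin n → ℕ) (v : ∀ i, Fin (k i) → V) :
    concat K V k (tprod K fun i => tprod K (v i)) =
      tprod K (fun z => v (Block.pos k z).1 (Block.pos k z).2) := by
  rw [concat, lift.tprod, blockLift_tprod]
  rfl

/-- Multilinear maps on tensor powers which agree on pure tensors are equal. -/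
theorem block_ext {ι : Type*} [Finite ι] {k : ι → ℕ} {E : Type*} [AddCommGroup E] [Module K E]
    {F G : MultilinearMap K (fun i => Pow K V (k i)) E}
    (h : ∀ v : ∀ i, Fin (k i) → V, F (fun i => tprod K (v i)) = G (fun i => tprod K (v i))) :
    F = G :=
  MultilinearMap.ext_of_span_eq_top (g := fun i (v : Fin (k i) → V) => tprod K v)
    (fun _ => span_tprod_eq_top) h

/-- The symmetric group action on tensor powers:
the factor numbered `i` becomes the factor numbered `σ i`. -/
noncomputable def powPerm {m n : ℕ} (σ : Fin m ≃ Fin n) : Pow K V m →ₗ[K] Pow K V n :=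
  (reindex K (fun _ => V) σ).toLinearMap

theorem powPerm_tprod {m n : ℕ} (σ : Fin m ≃ Fin n) (v : Fin m → V) :
    powPerm K V σ (tprod K v) = tprod K (fun i => v (σ.symm i)) :=
  reindex_tprod σ v

/-- Composition in the coendomorphism operad: `f ∘ (g 0, g 1, …)` is the composite
`V → V^{⊗ n} → V^{⊗ k 0} ⊗ V^{⊗ k 1} ⊗ … = V^{⊗ (k 0 + k 1 + …)}` of `f` and `g 0 ⊗ g 1 ⊗ …`. -/
noncomputable def coendComp {n : ℕ} (k : Fin n → ℕ) :
    (V →ₗ[K] Pow K V n) →ₗ[K]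
      MultilinearMap K (fun i => V →ₗ[K] Pow K V (k i)) (V →ₗ[K] Pow K V (∑ i, k i)) where
  toFun f := ((LinearMap.lcomp K _ f) ∘ₗ (LinearMap.llcomp K _ _ _ (concat K V k))).compMultilinearMap
      (mapMultilinear K (fun _ => V) (fun i => Pow K V (k i)))
  map_add' f g := by
    ext
    simp
  map_smul' c f := by
    ext
    simp

theorem coendComp_apply {n : ℕ} (k : Fin n → ℕ) (f : V →ₗ[K] Pow K V n)
    (g : ∀ i, V →ₗ[K] Pow K V (k i)) :
    coendComp K V k f g = concat K V k ∘ₗ map g ∘ₗ f :=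
  rfl

theorem concat_unitLeft {k : ℕ} (t : Pow K V k) :
    concat K V (fun _ : Fin 1 => k) (PiTensorProduct.tprod K fun _ => t) =
      powPerm K V (Block.unitLeft k) t := by
  have h : concat K V (fun _ : Fin 1 => k) ∘ₗ
      (subsingletonEquiv (R := K) (s := fun _ : Fin 1 => Pow K V k) 0).symm.toLinearMap =
      powPerm K V (Block.unitLeft k) := by
    ext v
    simp only [LinearMap.compMultilinearMap_apply, LinearMap.comp_apply, LinearEquiv.coe_coe,
      subsingletonEquiv_symm_apply']
    rw [concat_tprod, powPerm_tprod]
    refine congrArg _ (funext fun w => ?_)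
    obtain ⟨w, rfl⟩ := (Block.unitLeft k).surjective w
    rw [Equiv.symm_apply_apply]
    exact congrArg (fun y : Σ _ : Fin 1, Fin k => v y.2)
      (Block.pos_apply (fun _ : Fin 1 => k) ⟨0, w⟩)
  have h2 := LinearMap.congr_fun h t
  simpa only [LinearMap.comp_apply, LinearEquiv.coe_coe, subsingletonEquiv_symm_apply'] using h2

theorem concat_concat {n : ℕ} (k : Fin n → ℕ) (l : ∀ i, Fin (k i) → ℕ)
    (s : ∀ i j, Pow K V (l i j)) :
    concat K V (fun i => ∑ j, l i j)
        (PiTensorProduct.tprod K fun i => concat K V (l i) (PiTensorProduct.tprod K (s i))) =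
      powPerm K V (Block.assoc k l) (concat K V (fun z => l (Block.pos k z).1 (Block.pos k z).2)
        (PiTensorProduct.tprod K fun z => s (Block.pos k z).1 (Block.pos k z).2)) := by
  let F : MultilinearMap K (fun y : Σ i, Fin (k i) => Pow K V (l y.1 y.2))
      (Pow K V (∑ i, ∑ j, l i j)) :=
    (concat K V (fun i => ∑ j, l i j)).compMultilinearMap
      ((PiTensorProduct.tprod K).compMultilinearMap (N := fun i j => Pow K V (l i j))
        fun i => (concat K V (l i)).compMultilinearMap (PiTensorProduct.tprod K))
  let G : MultilinearMap K (fun y : Σ i, Fin (k i) => Pow K V (l y.1 y.2))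
      (Pow K V (∑ i, ∑ j, l i j)) :=
    (powPerm K V (Block.assoc k l) ∘ₗ concat K V (fun z => l (Block.pos k z).1 (Block.pos k z).2) ∘ₗ
      (reindex K (fun y : Σ i, Fin (k i) => Pow K V (l y.1 y.2))
        finSigmaFinEquiv).toLinearMap).compMultilinearMap (PiTensorProduct.tprod K)
  have hF : ∀ t : ∀ i j, Pow K V (l i j), F (fun y => t y.1 y.2) = concat K V (fun i => ∑ j, l i j)
        (PiTensorProduct.tprod K fun i => concat K V (l i) (PiTensorProduct.tprod K (t i))) :=
    fun t => rfl
  have hG : ∀ t : ∀ i j, Pow K V (l i j), G (fun y => t y.1 y.2) =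
      powPerm K V (Block.assoc k l) (concat K V (fun z => l (Block.pos k z).1 (Block.pos k z).2)
        (PiTensorProduct.tprod K fun z => t (Block.pos k z).1 (Block.pos k z).2)) := by
    intro t
    simp only [G, LinearMap.compMultilinearMap_apply, LinearMap.comp_apply, LinearEquiv.coe_coe]
    rw [reindex_tprod]
  rw [← hF, ← hG]
  suffices h : F = G by rw [h]
  refine block_ext K V fun v => ?_
  refine (hF fun i j => PiTensorProduct.tprod K (v ⟨i, j⟩)).trans
    (Eq.trans ?_ (hG fun i j => PiTensorProduct.tprod K (v ⟨i, j⟩)).symm)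
  simp only [concat_tprod]
  rw [powPerm_tprod]
  refine congrArg _ (funext fun w => ?_)
  obtain ⟨w, rfl⟩ := (Block.assoc k l).surjective w
  obtain ⟨⟨z, m⟩, rfl⟩ := finSigmaFinEquiv.surjective w
  rw [Equiv.symm_apply_apply, Block.assoc_apply]
  have h1 := congrArg (fun y : Σ i, Fin (∑ j, l i j) =>
    v ⟨y.1, (Block.pos (l y.1) y.2).1⟩ (Block.pos (l y.1) y.2).2)
    (Block.pos_apply (fun i => ∑ j, l i j)
      ⟨(Block.pos k z).1, finSigmaFinEquiv ⟨(Block.pos k z).2, m⟩⟩)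
  have h2 := congrArg (fun y : Σ j, Fin (l (Block.pos k z).1 j) => v ⟨(Block.pos k z).1, y.1⟩ y.2)
    (Block.pos_apply (l (Block.pos k z).1) ⟨(Block.pos k z).2, m⟩)
  have h3 := congrArg (fun y : Σ z, Fin (l (Block.pos k z).1 (Block.pos k z).2) =>
    v (Block.pos k y.1) y.2)
    (Block.pos_apply (fun z => l (Block.pos k z).1 (Block.pos k z).2) ⟨z, m⟩)
  exact h1.trans (h2.trans h3.symm)

theorem concat_outer {m n : ℕ} (σ : Fin m ≃ Fin n) (k : Fin n → ℕ) (t : ∀ j, Pow K V (k j)) :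
    concat K V k (PiTensorProduct.tprod K t) =
      powPerm K V (Block.outer σ k)
        (concat K V (fun i => k (σ i)) (PiTensorProduct.tprod K fun i => t (σ i))) := by
  let F : MultilinearMap K (fun j => Pow K V (k j)) (Pow K V (∑ j, k j)) :=
    (concat K V k).compMultilinearMap (PiTensorProduct.tprod K)
  let G : MultilinearMap K (fun j => Pow K V (k j)) (Pow K V (∑ j, k j)) :=
    (powPerm K V (Block.outer σ k) ∘ₗ concat K V (fun i => k (σ i)) ∘ₗ
      (reindex K (fun j => Pow K V (k j)) σ.symm).toLinearMap).compMultilinearMap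
        (PiTensorProduct.tprod K)
  have hG : ∀ t : ∀ j, Pow K V (k j), G t = powPerm K V (Block.outer σ k)
        (concat K V (fun i => k (σ i)) (PiTensorProduct.tprod K fun i => t (σ i))) := by
    intro t
    simp only [G, LinearMap.compMultilinearMap_apply, LinearMap.comp_apply, LinearEquiv.coe_coe]
    rw [reindex_tprod]
    rfl
  rw [← hG]
  suffices h : F = G from MultilinearMap.congr_fun h t
  refine block_ext K V fun v => ?_
  rw [hG, concat_tprod, powPerm_tprod]
  refine (concat_tprod K V k v).trans (congrArg _ (funext fun w => ?_))
  obtain ⟨w, rfl⟩ := (Block.outer σ k).surjective w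
  obtain ⟨⟨i, j⟩, rfl⟩ := finSigmaFinEquiv.surjective w
  rw [Equiv.symm_apply_apply, Block.outer_apply]
  have h1 := congrArg (fun y : Σ j, Fin (k j) => v y.1 y.2) (Block.pos_apply k ⟨σ i, j⟩)
  have h2 := congrArg (fun y : Σ i, Fin (k (σ i)) => v (σ y.1) y.2)
    (Block.pos_apply (fun i => k (σ i)) ⟨i, j⟩)
  exact h1.trans h2.symm

theorem concat_inner {n : ℕ} {k l : Fin n → ℕ} (τ : ∀ i, Fin (k i) ≃ Fin (l i))
    (t : ∀ i, Pow K V (k i)) :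
    concat K V l (PiTensorProduct.tprod K fun i => powPerm K V (τ i) (t i)) =
      powPerm K V (Block.inner τ) (concat K V k (PiTensorProduct.tprod K t)) := by
  let F : MultilinearMap K (fun i => Pow K V (k i)) (Pow K V (∑ i, l i)) :=
    (concat K V l ∘ₗ map fun i => powPerm K V (τ i)).compMultilinearMap (PiTensorProduct.tprod K)
  let G : MultilinearMap K (fun i => Pow K V (k i)) (Pow K V (∑ i, l i)) :=
    (powPerm K V (Block.inner τ) ∘ₗ concat K V k).compMultilinearMap (PiTensorProduct.tprod K)
  have hF : ∀ t : ∀ i, Pow K V (k i), F t =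
      concat K V l (PiTensorProduct.tprod K fun i => powPerm K V (τ i) (t i)) := by
    intro t
    simp only [F, LinearMap.compMultilinearMap_apply, LinearMap.comp_apply, map_tprod]
  rw [← hF]
  suffices h : F = G from MultilinearMap.congr_fun h t
  refine block_ext K V fun v => ?_
  rw [hF]
  simp only [powPerm_tprod]
  refine (concat_tprod K V l _).trans (Eq.trans (congrArg _ (funext fun w => ?_))
    ((congrArg _ (concat_tprod K V k v)).trans (powPerm_tprod K V _ _)).symm)
  obtain ⟨w, rfl⟩ := (Block.inner τ).surjective w
  obtain ⟨⟨i, j⟩, rfl⟩ := finSigmaFinEquiv.surjective w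
  rw [Equiv.symm_apply_apply, Block.inner_apply]
  have h1 := congrArg (fun y : Σ i, Fin (l i) => v y.1 ((τ y.1).symm y.2))
    (Block.pos_apply l ⟨i, τ i j⟩)
  have h2 := congrArg (fun y : Σ i, Fin (k i) => v y.1 y.2) (Block.pos_apply k ⟨i, j⟩)
  refine h1.trans (Eq.trans ?_ h2.symm)
  exact congrArg (v i) ((τ i).symm_apply_apply j)

/-- The coendomorphism operad of `V`; its operations of arity `n` are the linear maps
`V → V ⊗ … ⊗ V`. -/
noncomputable def coendOperad : LinOperad.{u, max u w} K where
  obj n := V →ₗ[K] Pow K V n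
  perm {m n} σ := LinearMap.llcomp K V (Pow K V m) (Pow K V n) (powPerm K V σ)
  one := (subsingletonEquiv (R := K) (s := fun _ : Fin 1 => V) 0).symm.toLinearMap
  comp k := coendComp K V k
  perm_refl f := by
    ext x
    simp [powPerm]
  perm_trans σ τ p := by
    ext x
    exact (reindex_reindex σ τ (p x)).symm
  one_comp {k} q := by
    ext x
    simp only [coendComp_apply, LinearMap.comp_apply, LinearEquiv.coe_coe,
      subsingletonEquiv_symm_apply', map_tprod]
    exact concat_unitLeft K V (q x)
  comp_one {n} p := by
    have h : concat K V (fun _ : Fin n => 1) ∘ₗ map (fun _ =>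
        (subsingletonEquiv (R := K) (s := fun _ : Fin 1 => V) 0).symm.toLinearMap) =
        powPerm K V (Block.unitRight n) := by
      ext v
      simp only [LinearMap.compMultilinearMap_apply, LinearMap.comp_apply, LinearEquiv.coe_coe,
        subsingletonEquiv_symm_apply', map_tprod]
      refine (concat_tprod K V (fun _ : Fin n => 1) (fun i _ => v i)).trans
        (Eq.trans ?_ (powPerm_tprod K V (Block.unitRight n) v).symm)
      rfl
    ext x
    exact LinearMap.congr_fun h (p x)
  comp_assoc k l p q r := by
    have h : concat K V (fun i => ∑ j, l i j) ∘ₗ map (fun i => concat K V (l i) ∘ₗ map (r i) ∘ₗ q i)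
        = powPerm K V (Block.assoc k l) ∘ₗ
          concat K V (fun z => l (Block.pos k z).1 (Block.pos k z).2) ∘ₗ
          map (fun z => r (Block.pos k z).1 (Block.pos k z).2) ∘ₗ concat K V k ∘ₗ map q := by
      have h1 : map (fun i => concat K V (l i) ∘ₗ map (r i) ∘ₗ q i) =
          map (fun i => concat K V (l i) ∘ₗ map (r i)) ∘ₗ map q := by
        rw [← map_comp]
        rfl
      rw [h1]
      simp only [← LinearMap.comp_assoc]
      refine congrArg (· ∘ₗ map q) (PiTensorProduct.ext (block_ext K V fun w => ?_))
      simp only [LinearMap.compMultilinearMap_apply, LinearMap.comp_apply, map_tprod]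
      rw [concat_tprod, map_tprod]
      exact concat_concat K V k l fun i j => r i j (w i j)
    ext x
    exact LinearMap.congr_fun h (p x)
  comp_perm_left σ k p q := by
    have h : concat K V k ∘ₗ map q ∘ₗ powPerm K V σ = powPerm K V (Block.outer σ k) ∘ₗ
        concat K V (fun i => k (σ i)) ∘ₗ map (fun i => q (σ i)) := by
      ext v
      simp only [LinearMap.compMultilinearMap_apply, LinearMap.comp_apply, powPerm_tprod, map_tprod]
      refine (concat_outer K V σ k _).trans (congrArg (fun t => powPerm K V (Block.outer σ k)
        (concat K V (fun i => k (σ i)) (PiTensorProduct.tprod K t))) (funext fun i => ?_))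
      rw [Equiv.symm_apply_apply]
    ext x
    exact LinearMap.congr_fun h (p x)
  comp_perm_right τ p q := by
    have h : concat K V _ ∘ₗ map (fun i => powPerm K V (τ i) ∘ₗ q i) =
        powPerm K V (Block.inner τ) ∘ₗ concat K V _ ∘ₗ map q := by
      ext v
      simp only [LinearMap.compMultilinearMap_apply, LinearMap.comp_apply, map_tprod]
      exact concat_inner K V τ fun i => q i (v i)
    ext x
    exact LinearMap.congr_fun h (p x)

end CoEnd

/-! ### Operads presented by generators and relations -/

/-- Formal expressions of arity `n` in the generators `G` and the structure operations of a
linear operad. -/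
inductive OpExpr (K : Type u) (G : ℕ → Type v) : ℕ → Type (max u v)
  | gen {n : ℕ} (g : G n) : OpExpr K G n
  | zero (n : ℕ) : OpExpr K G n
  | add {n : ℕ} (a b : OpExpr K G n) : OpExpr K G n
  | smul {n : ℕ} (c : K) (a : OpExpr K G n) : OpExpr K G n
  | perm {m n : ℕ} (σ : Fin m ≃ Fin n) (a : OpExpr K G m) : OpExpr K G n
  | one : OpExpr K G 1
  | comp {n : ℕ} (k : Fin n → ℕ) (a : OpExpr K G n) (b : ∀ i, OpExpr K G (k i)) :
      OpExpr K G (∑ i, k i)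

namespace OpExpr

variable {G : ℕ → Type v}

/-- The expression `p ∘ q`, for `p` of arity `1`. -/
def comp₁ {n : ℕ} (p : OpExpr K G 1) (q : OpExpr K G n) : OpExpr K G n :=
  .perm (Block.unitLeft n).symm (.comp (fun _ : Fin 1 => n) p fun _ => q)

/-- The expression `p ∘ (q ⊗ r)`, for `p` of arity `2`. -/
def comp₂ {m n : ℕ} (p : OpExpr K G 2) (q : OpExpr K G m) (r : OpExpr K G n) : OpExpr K G (m + n) :=
  .perm (finCongr (by simp)) (.comp ![m, n] p fun i => match i with | 0 => q | 1 => r)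

/-- The expression `a₁ + (a₂ + (… + 0))`. -/
def sum {n : ℕ} (L : List (OpExpr K G n)) : OpExpr K G n :=
  L.foldr .add (.zero n)

end OpExpr

/-- The smallest relation on expressions which contains the relations `R`, is an equivalence
relation compatible with all operations, and makes the axioms of a linear operad hold. -/
inductive Rel {G : ℕ → Type v} (R : ∀ n, OpExpr K G n → OpExpr K G n → Prop) :
    ∀ {n : ℕ}, OpExpr K G n → OpExpr K G n → Prop
  | of {n : ℕ} {a b : OpExpr K G n} : R n a b → Rel R a b
  | refl {n : ℕ} (a : OpExpr K G n) : Rel R a a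
  | symm {n : ℕ} {a b : OpExpr K G n} : Rel R a b → Rel R b a
  | trans {n : ℕ} {a b c : OpExpr K G n} : Rel R a b → Rel R b c → Rel R a c
  | add_congr {n : ℕ} {a a' b b' : OpExpr K G n} :
      Rel R a a' → Rel R b b' → Rel R (OpExpr.add a b) (OpExpr.add a' b')
  | smul_congr {n : ℕ} (c : K) {a a' : OpExpr K G n} : Rel R a a' → Rel R (OpExpr.smul c a) (OpExpr.smul c a')
  | perm_congr {m n : ℕ} (σ : Fin m ≃ Fin n) {a a' : OpExpr K G m} :
      Rel R a a' → Rel R (OpExpr.perm σ a) (OpExpr.perm σ a')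
  | comp_congr {n : ℕ} (k : Fin n → ℕ) {a a' : OpExpr K G n} {b b' : ∀ i, OpExpr K G (k i)} :
      Rel R a a' → (∀ i, Rel R (b i) (b' i)) → Rel R (OpExpr.comp k a b) (OpExpr.comp k a' b')
  | add_assoc {n : ℕ} (a b c : OpExpr K G n) : Rel R (OpExpr.add (OpExpr.add a b) c) (OpExpr.add a (OpExpr.add b c))
  | add_comm {n : ℕ} (a b : OpExpr K G n) : Rel R (OpExpr.add a b) (OpExpr.add b a)
  | zero_add {n : ℕ} (a : OpExpr K G n) : Rel R (OpExpr.add (OpExpr.zero n) a) a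
  | neg_add {n : ℕ} (a : OpExpr K G n) : Rel R (OpExpr.add (OpExpr.smul (-1) a) a) (OpExpr.zero n)
  | smul_add {n : ℕ} (c : K) (a b : OpExpr K G n) :
      Rel R (OpExpr.smul c (OpExpr.add a b)) (OpExpr.add (OpExpr.smul c a) (OpExpr.smul c b))
  | add_smul {n : ℕ} (c d : K) (a : OpExpr K G n) :
      Rel R (OpExpr.smul (c + d) a) (OpExpr.add (OpExpr.smul c a) (OpExpr.smul d a))
  | mul_smul {n : ℕ} (c d : K) (a : OpExpr K G n) : Rel R (OpExpr.smul (c * d) a) (OpExpr.smul c (OpExpr.smul d a))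
  | one_smul {n : ℕ} (a : OpExpr K G n) : Rel R (OpExpr.smul 1 a) a
  | perm_add {m n : ℕ} (σ : Fin m ≃ Fin n) (a b : OpExpr K G m) :
      Rel R (OpExpr.perm σ (OpExpr.add a b)) (OpExpr.add (OpExpr.perm σ a) (OpExpr.perm σ b))
  | perm_smul {m n : ℕ} (σ : Fin m ≃ Fin n) (c : K) (a : OpExpr K G m) :
      Rel R (OpExpr.perm σ (OpExpr.smul c a)) (OpExpr.smul c (OpExpr.perm σ a))
  | add_comp {n : ℕ} (k : Fin n → ℕ) (a a' : OpExpr K G n) (b : ∀ i, OpExpr K G (k i)) :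
      Rel R (OpExpr.comp k (OpExpr.add a a') b) (OpExpr.add (OpExpr.comp k a b) (OpExpr.comp k a' b))
  | smul_comp {n : ℕ} (k : Fin n → ℕ) (c : K) (a : OpExpr K G n) (b : ∀ i, OpExpr K G (k i)) :
      Rel R (OpExpr.comp k (OpExpr.smul c a) b) (OpExpr.smul c (OpExpr.comp k a b))
  | comp_add {n : ℕ} (k : Fin n → ℕ) (a : OpExpr K G n) (b : ∀ i, OpExpr K G (k i)) (i : Fin n)
      (x y : OpExpr K G (k i)) :
      Rel R (OpExpr.comp k a (Function.update b i (OpExpr.add x y)))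
        (OpExpr.add (OpExpr.comp k a (Function.update b i x)) (OpExpr.comp k a (Function.update b i y)))
  | comp_smul {n : ℕ} (k : Fin n → ℕ) (a : OpExpr K G n) (b : ∀ i, OpExpr K G (k i)) (i : Fin n)
      (c : K) (x : OpExpr K G (k i)) :
      Rel R (OpExpr.comp k a (Function.update b i (OpExpr.smul c x)))
        (OpExpr.smul c (OpExpr.comp k a (Function.update b i x)))
  | perm_refl {n : ℕ} (a : OpExpr K G n) : Rel R (OpExpr.perm (Equiv.refl (Fin n)) a) a
  | perm_trans {l m n : ℕ} (σ : Fin l ≃ Fin m) (τ : Fin m ≃ Fin n) (a : OpExpr K G l) :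
      Rel R (OpExpr.perm (σ.trans τ) a) (OpExpr.perm τ (OpExpr.perm σ a))
  | one_comp {k : ℕ} (b : OpExpr K G k) :
      Rel R (OpExpr.comp (fun _ : Fin 1 => k) OpExpr.one (fun _ => b)) (OpExpr.perm (Block.unitLeft k) b)
  | comp_one {n : ℕ} (a : OpExpr K G n) :
      Rel R (OpExpr.comp (fun _ : Fin n => 1) a (fun _ => OpExpr.one)) (OpExpr.perm (Block.unitRight n) a)
  | comp_assoc {n : ℕ} (k : Fin n → ℕ) (l : ∀ i, Fin (k i) → ℕ)
      (a : OpExpr K G n) (b : ∀ i, OpExpr K G (k i)) (c : ∀ i j, OpExpr K G (l i j)) :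
      Rel R (OpExpr.comp (fun i => ∑ j, l i j) a (fun i => OpExpr.comp (l i) (b i) (c i)))
        (OpExpr.perm (Block.assoc k l)
          (OpExpr.comp (fun z => l (Block.pos k z).1 (Block.pos k z).2) (OpExpr.comp k a b)
            (fun z => c (Block.pos k z).1 (Block.pos k z).2)))
  | comp_perm_left {m n : ℕ} (σ : Fin m ≃ Fin n) (k : Fin n → ℕ)
      (a : OpExpr K G m) (b : ∀ j, OpExpr K G (k j)) :
      Rel R (OpExpr.comp k (OpExpr.perm σ a) b)
        (OpExpr.perm (Block.outer σ k) (OpExpr.comp (fun i => k (σ i)) a (fun i => b (σ i))))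
  | comp_perm_right {n : ℕ} {k l : Fin n → ℕ} (τ : ∀ i, Fin (k i) ≃ Fin (l i))
      (a : OpExpr K G n) (b : ∀ i, OpExpr K G (k i)) :
      Rel R (OpExpr.comp l a (fun i => OpExpr.perm (τ i) (b i))) (OpExpr.perm (Block.inner τ) (OpExpr.comp k a b))

section Presented

variable {G : ℕ → Type v} (R : ∀ n, OpExpr K G n → OpExpr K G n → Prop)

/-- The congruence generated by `R`, as a setoid. -/
def relSetoid (n : ℕ) : Setoid (OpExpr K G n) where
  r := Rel R
  iseqv := ⟨Rel.refl, Rel.symm, Rel.trans⟩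

/-- The operations of arity `n` of the operad presented by `G` and `R`. -/
def PresObj (n : ℕ) : Type (max u v) := Quotient (relSetoid R n)

namespace PresObj

variable {R}

/-- The class of an expression. -/
def mk {n : ℕ} (a : OpExpr K G n) : PresObj R n := Quotient.mk (relSetoid R n) a

theorem sound {n : ℕ} {a b : OpExpr K G n} (h : Rel R a b) : (mk a : PresObj R n) = mk b :=
  Quotient.sound h

theorem exact {n : ℕ} {a b : OpExpr K G n} (h : (mk a : PresObj R n) = mk b) : Rel R a b :=
  Quotient.exact h

theorem mk_surjective {n : ℕ} (a : PresObj R n) : ∃ b, mk b = a :=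
  Quotient.exists_rep a

theorem mk_out {n : ℕ} (a : PresObj R n) : mk (Quotient.out a) = a :=
  Quotient.out_eq a

instance instAdd (n : ℕ) : Add (PresObj R n) where
  add := Quotient.map₂ OpExpr.add fun _ _ h _ _ h' => Rel.add_congr h h'

instance instZero (n : ℕ) : Zero (PresObj R n) where
  zero := mk (OpExpr.zero n)

instance instNeg (n : ℕ) : Neg (PresObj R n) where
  neg := Quotient.map (OpExpr.smul (-1)) fun _ _ h => Rel.smul_congr _ h

instance addCommGroup (n : ℕ) : AddCommGroup (PresObj R n) where
  add_assoc := by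
    rintro ⟨a⟩ ⟨b⟩ ⟨c⟩
    exact sound (Rel.add_assoc a b c)
  zero_add := by
    rintro ⟨a⟩
    exact sound (Rel.zero_add a)
  add_zero := by
    rintro ⟨a⟩
    exact sound ((Rel.add_comm _ _).trans (Rel.zero_add a))
  neg_add_cancel := by
    rintro ⟨a⟩
    exact sound (Rel.neg_add a)
  add_comm := by
    rintro ⟨a⟩ ⟨b⟩
    exact sound (Rel.add_comm a b)
  nsmul := nsmulRec
  zsmul := zsmulRec

instance instSMul (n : ℕ) : SMul K (PresObj R n) where
  smul c := Quotient.map (OpExpr.smul c) fun _ _ h => Rel.smul_congr c h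

instance module (n : ℕ) : Module K (PresObj R n) :=
  Module.ofMinimalAxioms
    (by
      rintro c ⟨a⟩ ⟨b⟩
      exact sound (Rel.smul_add c a b))
    (by
      rintro c d ⟨a⟩
      exact sound (Rel.add_smul c d a))
    (by
      rintro c d ⟨a⟩
      exact sound (Rel.mul_smul c d a))
    (by
      rintro ⟨a⟩
      exact sound (Rel.one_smul a))

/-- Relabeling, induced by relabeling of expressions. -/
def perm {m n : ℕ} (σ : Fin m ≃ Fin n) : PresObj R m →ₗ[K] PresObj R n where
  toFun := Quotient.map (OpExpr.perm σ) fun _ _ h => Rel.perm_congr σ h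
  map_add' := by
    rintro ⟨a⟩ ⟨b⟩
    exact sound (Rel.perm_add σ a b)
  map_smul' := by
    rintro c ⟨a⟩
    exact sound (Rel.perm_smul σ c a)

/-- Composition, induced by composition of expressions (see `compFun_mk`). -/
noncomputable def compFun {n : ℕ} (k : Fin n → ℕ) (a : PresObj R n) (b : ∀ i, PresObj R (k i)) :
    PresObj R (∑ i, k i) :=
  mk (OpExpr.comp k (Quotient.out a) fun i => Quotient.out (b i))

theorem compFun_mk {n : ℕ} (k : Fin n → ℕ) (a : OpExpr K G n) (b : ∀ i, OpExpr K G (k i)) :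
    compFun k (mk a : PresObj R n) (fun i => mk (b i)) = mk (OpExpr.comp k a b) :=
  sound (Rel.comp_congr k (exact (mk_out _)) fun _ => exact (mk_out _))

theorem mk_update {n : ℕ} {k : Fin n → ℕ} [DecidableEq (Fin n)] (b : ∀ i, OpExpr K G (k i))
    (i : Fin n) (y : OpExpr K G (k i)) :
    Function.update (fun j => (mk (b j) : PresObj R (k j))) i (mk y) =
      fun j => mk (Function.update b i y j) := by
  funext j
  by_cases h : j = i
  · subst h; simp
  · simp [h]

/-- Composition as a multilinear operation. -/
noncomputable def comp {n : ℕ} (k : Fin n → ℕ) :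
    PresObj R n →ₗ[K]
      MultilinearMap K (fun i => PresObj R (k i)) (PresObj R (∑ i, k i)) where
  toFun a :=
    { toFun := fun b => compFun k a b
      map_update_add' := by
        intro hdec b i x y
        obtain rfl : hdec = instDecidableEqFin n := Subsingleton.elim _ _
        obtain ⟨a, rfl⟩ := mk_surjective a
        choose c hc using fun j => mk_surjective (b j)
        obtain rfl : (fun j => mk (c j)) = b := funext hc
        obtain ⟨x, rfl⟩ := mk_surjective x
        obtain ⟨y, rfl⟩ := mk_surjective y
        have h : (mk x + mk y : PresObj R (k i)) = mk (OpExpr.add x y) := rfl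
        rw [h]
        simp only [mk_update, compFun_mk]
        exact sound (Rel.comp_add k a c i x y)
      map_update_smul' := by
        intro hdec b i r x
        obtain rfl : hdec = instDecidableEqFin n := Subsingleton.elim _ _
        obtain ⟨a, rfl⟩ := mk_surjective a
        choose c hc using fun j => mk_surjective (b j)
        obtain rfl : (fun j => mk (c j)) = b := funext hc
        obtain ⟨x, rfl⟩ := mk_surjective x
        have h : (r • mk x : PresObj R (k i)) = mk (OpExpr.smul r x) := rfl
        rw [h]
        simp only [mk_update, compFun_mk]
        exact sound (Rel.comp_smul k a c i r x) }
  map_add' a a' := by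
    ext b
    obtain ⟨a, rfl⟩ := mk_surjective a
    obtain ⟨a', rfl⟩ := mk_surjective a'
    choose c hc using fun j => mk_surjective (b j)
    obtain rfl : (fun j => mk (c j)) = b := funext hc
    have h : (mk a + mk a' : PresObj R n) = mk (OpExpr.add a a') := rfl
    rw [h]
    simp only [MultilinearMap.coe_mk, add_apply, compFun_mk]
    exact sound (Rel.add_comp k a a' c)
  map_smul' r a := by
    ext b
    obtain ⟨a, rfl⟩ := mk_surjective a
    choose c hc using fun j => mk_surjective (b j)
    obtain rfl : (fun j => mk (c j)) = b := funext hc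
    have h : (r • mk a : PresObj R n) = mk (OpExpr.smul r a) := rfl
    rw [h]
    simp only [MultilinearMap.coe_mk, smul_apply, compFun_mk, RingHom.id_apply]
    exact sound (Rel.smul_comp k r a c)

theorem comp_mk {n : ℕ} (k : Fin n → ℕ) (a : OpExpr K G n) (b : ∀ i, OpExpr K G (k i)) :
    comp k (mk a : PresObj R n) (fun i => mk (b i)) = mk (OpExpr.comp k a b) :=
  compFun_mk k a b

end PresObj

/-- The linear operad with generators `G` and relations `R`. -/
noncomputable def presented : LinOperad.{u, max u v} K where
  obj n := PresObj R n
  perm σ := PresObj.perm σ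
  one := PresObj.mk OpExpr.one
  comp k := PresObj.comp k
  perm_refl := by
    rintro n ⟨a⟩
    exact PresObj.sound (Rel.perm_refl a)
  perm_trans := by
    rintro l m n σ τ ⟨a⟩
    exact PresObj.sound (Rel.perm_trans σ τ a)
  one_comp := by
    intro k q
    obtain ⟨b, rfl⟩ := PresObj.mk_surjective q
    rw [PresObj.comp_mk]
    exact PresObj.sound (Rel.one_comp b)
  comp_one := by
    intro n p
    obtain ⟨a, rfl⟩ := PresObj.mk_surjective p
    rw [PresObj.comp_mk]
    exact PresObj.sound (Rel.comp_one a)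
  comp_assoc := by
    intro n k l p q r
    obtain ⟨a, rfl⟩ := PresObj.mk_surjective p
    choose b hb using fun i => PresObj.mk_surjective (q i)
    obtain rfl : (fun i => PresObj.mk (b i)) = q := funext hb
    choose c hc using fun i j => PresObj.mk_surjective (r i j)
    obtain rfl : (fun i j => PresObj.mk (c i j)) = r := funext fun i => funext (hc i)
    simp only [PresObj.comp_mk]
    exact PresObj.sound (Rel.comp_assoc k l a b c)
  comp_perm_left := by
    intro m n σ k p q
    obtain ⟨a, rfl⟩ := PresObj.mk_surjective p
    choose b hb using fun i => PresObj.mk_surjective (q i)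
    obtain rfl : (fun i => PresObj.mk (b i)) = q := funext hb
    have h : PresObj.perm σ (PresObj.mk a : PresObj R m) = PresObj.mk (OpExpr.perm σ a) := rfl
    rw [h]
    simp only [PresObj.comp_mk]
    exact PresObj.sound (Rel.comp_perm_left σ k a b)
  comp_perm_right := by
    intro n k l τ p q
    obtain ⟨a, rfl⟩ := PresObj.mk_surjective p
    choose b hb using fun i => PresObj.mk_surjective (q i)
    obtain rfl : (fun i => PresObj.mk (b i)) = q := funext hb
    have h : ∀ i, PresObj.perm (τ i) (PresObj.mk (b i) : PresObj R (k i)) =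
      PresObj.mk (OpExpr.perm (τ i) (b i)) := fun _ => rfl
    simp only [h, PresObj.comp_mk]
    exact PresObj.sound (Rel.comp_perm_right τ a b)

end Presented

/-! ### Algebras and coalgebras over an operad -/

/-- A structure of `P`-algebra on `V`. -/
abbrev AlgebraOn (P : LinOperad.{u, v} K) (V : Type w) [AddCommGroup V] [Module K V] :
    Type (max v w) :=
  Hom P (endOperad K V)

/-- The multilinear operation on a `P`-algebra given by an operation `p` of `P`. -/
noncomputable def AlgebraOn.op {P : LinOperad.{u, v} K} {V : Type w} [AddCommGroup V] [Module K V]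
    (α : AlgebraOn P V) {n : ℕ} (p : P.obj n) : MultilinearMap K (fun _ : Fin n => V) V :=
  α.app n p

/-- A structure of `P`-coalgebra on `V`. -/
abbrev CoalgebraOn (P : LinOperad.{u, v} K) (V : Type w) [AddCommGroup V] [Module K V] :
    Type (max u v w) :=
  Hom P (coendOperad K V)

/-- `P`-coalgebras. -/
structure Coalg (P : LinOperad.{u, v} K) : Type (max u v (w + 1)) where
  carrier : ModuleCat.{w} K
  str : CoalgebraOn P carrier

namespace Coalg

variable {P : LinOperad.{u, v} K}

/-- The cooperation `V → V^{⊗ n}` given by an operation `p` of arity `n`. -/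
noncomputable def coop (V : Coalg.{u, v, w} P) {n : ℕ} (p : P.obj n) : V.carrier →ₗ[K] Pow K V.carrier n :=
  V.str.app n p

/-- Morphisms of `P`-coalgebras: linear maps `f : V → W` such that `f^{⊗ n} ∘ p_V = p_W ∘ f` for
every operation `p` of arity `n`. -/
@[ext]
structure Hom (V W : Coalg.{u, v, w} P) where
  toLinearMap : V.carrier →ₗ[K] W.carrier
  comm : ∀ {n : ℕ} (p : P.obj n) (x : V.carrier),
    PiTensorProduct.map (fun _ : Fin n => toLinearMap) (V.coop p x) = W.coop p (toLinearMap x)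

noncomputable instance category : Category (Coalg.{u, v, w} P) where
  Hom V W := Hom V W
  id V := ⟨LinearMap.id, fun p x => by rw [PiTensorProduct.map_id]; rfl⟩
  comp f g := ⟨g.toLinearMap ∘ₗ f.toLinearMap, fun p x => by
    rw [PiTensorProduct.map_comp, LinearMap.comp_apply, f.comm, g.comm, LinearMap.comp_apply]⟩

/-- The forgetful functor from `P`-coalgebras to vector spaces. -/
noncomputable def forget (P : LinOperad.{u, v} K) : Coalg.{u, v, w} P ⥤ ModuleCat.{w} K where
  obj V := V.carrier
  map f := ModuleCat.ofHom (Hom.toLinearMap f)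

end Coalg
end LinOperad

/-! ### The operad `Ins` -/

open LinOperad

/-- Generators of `Ins`: the multiplication and the unit `υ 0` of the unital associative operad, the
additional operations `υ n` (`n ≥ 1`) of arity zero, and the operations `I_l` of arity one. -/
inductive InsGen (K : Type u) [Field K] : ℕ → Type u
  | mul : InsGen K 2
  | ups (n : ℕ) : InsGen K 0
  | inv (l : {l : ℕ →₀ K // l ≠ 0}) : InsGen K 1

namespace InsGen

variable (K : Type u) [Field K]

/-- The expression `∑ n, l n • υ n`. -/
noncomputable def lin (l : ℕ →₀ K) : OpExpr K (InsGen K) 0 :=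
  OpExpr.sum (l.support.sort.map fun n => .smul (l n) (.gen (ups n)))

/-- The defining relations of `Ins`: those of the unital associative operad, and
`μ ∘ ((∑ n, l n • υ n) ⊗ id) ∘ I_l = id`. -/
inductive Relation : ∀ n, OpExpr K (InsGen K) n → OpExpr K (InsGen K) n → Prop
  | assoc : Relation 3 (.comp₂ (.gen mul) (.gen mul) .one) (.comp₂ (.gen mul) .one (.gen mul))
  | unit_left : Relation 1 (.comp₂ (.gen mul) (.gen (ups 0)) .one) .one
  | unit_right : Relation 1 (.comp₂ (.gen mul) .one (.gen (ups 0))) .one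
  | inv (l : {l : ℕ →₀ K // l ≠ 0}) :
      Relation 1 (.comp₁ (.comp₂ (.gen mul) (lin K l.1) .one) (.gen (InsGen.inv l))) .one

end InsGen

/-- The operad `Ins` over `K`. -/
noncomputable def Ins (K : Type u) [Field K] : LinOperad.{u, u} K :=
  presented (InsGen.Relation K)

namespace Ins

variable (K : Type u) [Field K]

/-- The operation `μ` of `Ins`. -/
noncomputable def mul : (Ins K).obj 2 := PresObj.mk (.gen .mul)

/-- The operation `υ n` of `Ins`. -/
noncomputable def ups (n : ℕ) : (Ins K).obj 0 := PresObj.mk (.gen (.ups n))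

/-- The operation `I_l` of `Ins`. -/
noncomputable def inv (l : {l : ℕ →₀ K // l ≠ 0}) : (Ins K).obj 1 := PresObj.mk (.gen (.inv l))

variable {V : Type v} [AddCommGroup V] [Module K V]

/-- The multiplication `μ`, constants `υ n` and operators `I_l` make `V` a unital associative
algebra with unit `υ 0`, such that `(∑ n, l n • υ n) * I_l x = x`. -/
structure Axioms (μ : V →ₗ[K] V →ₗ[K] V) (υ : ℕ → V)
    (I : {l : ℕ →₀ K // l ≠ 0} → V →ₗ[K] V) : Prop where
  assoc : ∀ x y z, μ (μ x y) z = μ x (μ y z)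
  unit_left : ∀ x, μ (υ 0) x = x
  unit_right : ∀ x, μ x (υ 0) = x
  inv : ∀ (l : {l : ℕ →₀ K // l ≠ 0}) (x : V), μ (l.1.sum fun n c => c • υ n) (I l x) = x

/-- The `Ins`-algebra structure `α` on `V` is the one whose multiplication, constants and operators
are `μ`, `υ` and `I`. -/
structure IsGivenBy (α : AlgebraOn (Ins K) V) (μ : V →ₗ[K] V →ₗ[K] V) (υ : ℕ → V)
    (I : {l : ℕ →₀ K // l ≠ 0} → V →ₗ[K] V) : Prop where
  mul : ∀ x y : V, AlgebraOn.op α (mul K) ![x, y] = μ x y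
  ups : ∀ n : ℕ, AlgebraOn.op α (ups K n) ![] = υ n
  inv : ∀ (l : {l : ℕ →₀ K // l ≠ 0}) (x : V), AlgebraOn.op α (inv K l) ![x] = I l x

end Ins

/-!
A presented operad has the expected universal property: a morphism from it to `Q` is the same as a
choice of values of the generators in `Q` for which the relations hold (`presentedLift`,
`Hom.app_mk`, `Hom.presented_ext`). For `Q` an endomorphism operad, computing both sides of each
relation of `Ins` turns this into the description of `Ins`-algebras (`Ins.endValue_relation_iff`).
In a field extension `L` of infinite degree with independent elements `υ n`, every nonzero
combination of the `υ n` is invertible, so that `L` is an `Ins`-algebra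
(`Ins.axioms_of_linearIndependent`). For `L = K(X)` the identity of `L` is not zero, hence neither
is the identity operation of `Ins`.

In a coalgebra the constants `υ n` become linear forms `ε n`, and the last relation says that `x` can
be recovered from the contraction of the left factor of `Δ x` with `∑ n, l n • ε n`, for each
`l ≠ 0`. But `Δ x` is a finite sum of pure tensors, while there are infinitely many forms `ε n`: some
combination with `l ≠ 0` vanishes on all left factors of `Δ x`, so `x = 0`
(`Ins.subsingleton_of_coalgebraOn`). All coalgebras being zero, a functor which is constant at the
zero coalgebra is right adjoint to the forgetful functor, and any comonad induced by such an
adjunction has zero values.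
-/

namespace LinOperad

variable {K : Type u} [Field K] {G : ℕ → Type v}

/-! ### The universal property of a presented operad -/

/-- The value of a formal expression in an operad `Q`, given values of the generators in `Q`. -/
def OpExpr.eval (Q : LinOperad.{u, w} K) (g : ∀ n, G n → Q.obj n) :
    ∀ {n : ℕ}, OpExpr K G n → Q.obj n
  | _, .gen a => g _ a
  | _, .zero _ => 0
  | _, .add a b => a.eval Q g + b.eval Q g
  | _, .smul c a => c • a.eval Q g
  | _, .perm σ a => Q.perm σ (a.eval Q g)
  | _, .one => Q.one
  | _, .comp k a b => Q.comp k (a.eval Q g) fun i => (b i).eval Q g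

theorem OpExpr.eval_sum (Q : LinOperad.{u, w} K) (g : ∀ n, G n → Q.obj n) {n : ℕ}
    (L : List (OpExpr K G n)) :
    (OpExpr.sum L).eval Q g = (L.map fun a => a.eval Q g).sum := by
  induction L with
  | nil => rfl
  | cons a L ih => exact congrArg (a.eval Q g + ·) ih

theorem OpExpr.eval_update (Q : LinOperad.{u, w} K) (g : ∀ n, G n → Q.obj n) {n : ℕ}
    {k : Fin n → ℕ} (b : ∀ i, OpExpr K G (k i)) (i : Fin n) (y : OpExpr K G (k i)) :
    (fun j => (Function.update b i y j).eval Q g) =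
      Function.update (fun j => (b j).eval Q g) i (y.eval Q g) := by
  funext j
  by_cases h : j = i
  · subst h; simp
  · simp [h]

/-- Values satisfying the relations `R` satisfy the congruence generated by `R`. -/
theorem Rel.eval_eq {R : ∀ n, OpExpr K G n → OpExpr K G n → Prop} (Q : LinOperad.{u, w} K)
    (g : ∀ n, G n → Q.obj n) (hR : ∀ n a b, R n a b → a.eval Q g = b.eval Q g) {n : ℕ}
    {a b : OpExpr K G n} (h : Rel R a b) : a.eval Q g = b.eval Q g := by
  induction h with
  | of h => exact hR _ _ _ h
  | refl a => rfl
  | symm _ ih => exact ih.symm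
  | trans _ _ ih ih' => exact ih.trans ih'
  | add_congr _ _ ih ih' => exact congrArg₂ (· + ·) ih ih'
  | smul_congr c _ ih => exact congrArg (c • ·) ih
  | perm_congr σ _ ih => exact congrArg (Q.perm σ) ih
  | comp_congr k _ _ ih ih' =>
    simp only [OpExpr.eval]
    rw [ih, funext ih']
  | add_assoc a b c => exact _root_.add_assoc _ _ _
  | add_comm a b => exact _root_.add_comm _ _
  | zero_add a => exact _root_.zero_add _
  | neg_add a => simp [OpExpr.eval]
  | smul_add c a b => exact _root_.smul_add _ _ _
  | add_smul c d a => exact _root_.add_smul _ _ _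
  | mul_smul c d a => exact SemigroupAction.mul_smul _ _ _
  | one_smul a => exact _root_.one_smul _ _
  | perm_add σ a b => exact map_add _ _ _
  | perm_smul σ c a => exact map_smul _ _ _
  | add_comp k a a' b => simp [OpExpr.eval]
  | smul_comp k c a b => simp [OpExpr.eval]
  | comp_add k a b i x y =>
    simp only [OpExpr.eval, OpExpr.eval_update, MultilinearMap.map_update_add]
  | comp_smul k a b i c x =>
    simp only [OpExpr.eval, OpExpr.eval_update, MultilinearMap.map_update_smul]
  | perm_refl a => exact Q.perm_refl _
  | perm_trans σ τ a => exact Q.perm_trans _ _ _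
  | one_comp b => exact Q.one_comp _
  | comp_one a => exact Q.comp_one _
  | comp_assoc k l a b c => exact Q.comp_assoc k l _ _ _
  | comp_perm_left σ k a b => exact Q.comp_perm_left σ k _ _
  | comp_perm_right τ a b => exact Q.comp_perm_right τ _ _

/-- The morphism from a presented operad given by values of the generators which satisfy the
relations. -/
noncomputable def presentedLift {R : ∀ n, OpExpr K G n → OpExpr K G n → Prop}
    (Q : LinOperad.{u, w} K) (g : ∀ n, G n → Q.obj n)
    (hR : ∀ n a b, R n a b → a.eval Q g = b.eval Q g) : Hom (presented R) Q where
  app n :=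
    { toFun := Quotient.lift (fun a => a.eval Q g) fun _ _ h => Rel.eval_eq Q g hR h
      map_add' := by
        rintro ⟨a⟩ ⟨b⟩
        rfl
      map_smul' := by
        rintro c ⟨a⟩
        rfl }
  map_perm := by
    rintro m n σ ⟨a⟩
    rfl
  map_one := rfl
  map_comp := by
    intro n k p q
    obtain ⟨a, rfl⟩ := PresObj.mk_surjective p
    choose b hb using fun i => PresObj.mk_surjective (q i)
    obtain rfl : (fun i => PresObj.mk (b i)) = q := funext hb
    have h : (presented R).comp k (PresObj.mk a) (fun i => PresObj.mk (b i)) =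
      PresObj.mk (OpExpr.comp k a b) := PresObj.comp_mk k a b
    rw [h]
    rfl

/-- A morphism from a presented operad is evaluation at its values on the generators. -/
theorem Hom.app_mk {R : ∀ n, OpExpr K G n → OpExpr K G n → Prop} {Q : LinOperad.{u, w} K}
    (α : Hom (presented R) Q) {n : ℕ} (a : OpExpr K G n) :
    α.app n (PresObj.mk a) = a.eval Q fun n c => α.app n (PresObj.mk (.gen c)) := by
  induction a with
  | gen c => rfl
  | zero n => exact map_zero (α.app n)
  | add a b ih ih' => exact (map_add (α.app _) _ _).trans (congrArg₂ (· + ·) ih ih')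
  | smul c a ih => exact (map_smul (α.app _) _ _).trans (congrArg (c • ·) ih)
  | perm σ a ih => exact (α.map_perm σ _).trans (congrArg (Q.perm σ) ih)
  | one => exact α.map_one
  | comp k a b ih ih' =>
    have h : (presented R).comp k (PresObj.mk a) (fun i => PresObj.mk (b i)) =
      PresObj.mk (OpExpr.comp k a b) := PresObj.comp_mk k a b
    refine (congrArg (α.app _) h).symm.trans ((α.map_comp k _ _).trans ?_)
    exact congrArg₂ (fun p q => Q.comp k p q) ih (funext ih')

theorem Hom.eval_eq_of_rel {R : ∀ n, OpExpr K G n → OpExpr K G n → Prop} {Q : LinOperad.{u, w} K}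
    (α : Hom (presented R) Q) {n : ℕ} {a b : OpExpr K G n} (h : R n a b) :
    a.eval Q (fun n c => α.app n (PresObj.mk (.gen c))) =
      b.eval Q fun n c => α.app n (PresObj.mk (.gen c)) := by
  rw [← α.app_mk, ← α.app_mk, PresObj.sound (Rel.of h)]

theorem Hom.presented_ext {R : ∀ n, OpExpr K G n → OpExpr K G n → Prop} {Q : LinOperad.{u, w} K}
    {α β : Hom (presented R) Q}
    (h : ∀ n (c : G n), α.app n (PresObj.mk (.gen c)) = β.app n (PresObj.mk (.gen c))) :
    α = β := by
  ext n p
  obtain ⟨a, rfl⟩ := PresObj.mk_surjective p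
  rw [α.app_mk, β.app_mk, funext fun n => funext (h n)]

end LinOperad

/-! ### Algebras over `Ins` -/

namespace InsGen

variable {K : Type u} [Field K]

theorem eval_lin (Q : LinOperad.{u, w} K) (g : ∀ n, InsGen K n → Q.obj n) (l : ℕ →₀ K) :
    (lin K l).eval Q g = l.sum fun n c => c • g 0 (ups n) := by
  rw [lin, OpExpr.eval_sum, List.map_map, Finsupp.sum, Finset.sum,
    ← Finset.sort_eq l.support (· ≤ ·), Multiset.map_coe, Multiset.sum_coe]
  rfl

end InsGen

namespace LinOperad

section End

variable {K : Type u} [Field K] {G : ℕ → Type v} {V : Type w} [AddCommGroup V] [Module K V]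

theorem endOperad_comp₁_apply {n : ℕ} (p : MultilinearMap K (fun _ : Fin 1 => V) V)
    (q : MultilinearMap K (fun _ : Fin n => V) V) (v : Fin n → V) :
    MultilinearMap.domDomCongr (Block.unitLeft n).symm
      (endComp K V (fun _ : Fin 1 => n) p fun _ => q) v = p ![q v] := by
  rw [MultilinearMap.domDomCongr_apply, endComp_apply]
  refine congrArg p (funext fun i => ?_)
  obtain rfl := Subsingleton.elim i 0
  have h (j : Fin n) : (Block.unitLeft n).symm
      (finSigmaFinEquiv (⟨0, j⟩ : Σ i : Fin 1, Fin ((fun _ => n) i))) = j := by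
    rw [Equiv.symm_apply_eq]
    rfl
  exact congrArg q (funext fun j => congrArg v (h j))

theorem endOperad_comp₂_apply {m n : ℕ} (h : ∑ i, ![m, n] i = m + n)
    (p : MultilinearMap K (fun _ : Fin 2 => V) V)
    (q : ∀ i, MultilinearMap K (fun _ : Fin (![m, n] i) => V) V) (v : Fin (m + n) → V) :
    MultilinearMap.domDomCongr (finCongr h) (endComp K V ![m, n] p q) v =
      p ![q 0 fun i => v (Fin.castAdd n i), q 1 fun i => v (Fin.natAdd m i)] := by
  rw [MultilinearMap.domDomCongr_apply, endComp_apply]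
  refine congrArg p (funext fun i => ?_)
  match i with
  | 0 =>
    refine congrArg (q 0) (funext fun j => congrArg v (Fin.ext ?_))
    refine (finSigmaFinEquiv_apply (n := ![m, n]) ⟨0, j⟩).trans ?_
    simp
    rfl
  | 1 =>
    refine congrArg (q 1) (funext fun j => congrArg v (Fin.ext ?_))
    refine (finSigmaFinEquiv_apply (n := ![m, n]) ⟨1, j⟩).trans ?_
    simp
    rfl

/-- The underlying multilinear map of an operation of the endomorphism operad; it makes the
definition of the operad visible where such an operation is applied to vectors. -/
abbrev toMultilinear {n : ℕ} (p : (endOperad K V).obj n) :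
    MultilinearMap K (fun _ : Fin n => V) V := p

theorem OpExpr.eval_comp₁_endOperad (g : ∀ n, G n → (endOperad K V).obj n) {n : ℕ}
    (p : OpExpr K G 1) (q : OpExpr K G n) (v : Fin n → V) :
    toMultilinear ((p.comp₁ q).eval (endOperad K V) g) v =
      toMultilinear (p.eval (endOperad K V) g) ![toMultilinear (q.eval (endOperad K V) g) v] := by
  rw [OpExpr.comp₁, OpExpr.eval, OpExpr.eval]
  exact endOperad_comp₁_apply _ _ v

theorem OpExpr.eval_comp₂_endOperad (g : ∀ n, G n → (endOperad K V).obj n) {m n : ℕ}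
    (p : OpExpr K G 2) (q : OpExpr K G m) (r : OpExpr K G n) (v : Fin (m + n) → V) :
    toMultilinear ((p.comp₂ q r).eval (endOperad K V) g) v =
      toMultilinear (p.eval (endOperad K V) g)
        ![toMultilinear (q.eval (endOperad K V) g) fun i => v (i.castAdd n),
          toMultilinear (r.eval (endOperad K V) g) fun i => v (i.natAdd m)] := by
  rw [OpExpr.comp₂, OpExpr.eval, OpExpr.eval]
  exact endOperad_comp₂_apply _ _ _ v

end End
end LinOperad

namespace Ins

variable {K : Type u} [Field K] {V : Type v} [AddCommGroup V] [Module K V]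

/-- The constants, multiplication and operators, as values of the generators of `Ins` in the
endomorphism operad. -/
noncomputable def endValue (μ : V →ₗ[K] V →ₗ[K] V) (υ : ℕ → V)
    (I : {l : ℕ →₀ K // l ≠ 0} → V →ₗ[K] V) : ∀ n, InsGen K n → (endOperad K V).obj n
  | _, .mul => LinearMap.uncurryLeft (M := fun _ : Fin 2 => V)
      ((MultilinearMap.ofSubsingletonₗ K K V V (0 : Fin 1)).toLinearMap ∘ₗ μ)
  | _, .ups n => MultilinearMap.constOfIsEmpty K (fun _ : Fin 0 => V) (υ n)
  | _, .inv l => MultilinearMap.ofSubsingleton K V V (0 : Fin 1) (I l)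

theorem toMultilinear_eval_lin (g : ∀ n, InsGen K n → (endOperad K V).obj n) (l : ℕ →₀ K)
    (v : Fin 0 → V) : toMultilinear ((InsGen.lin K l).eval (endOperad K V) g) v =
      l.sum fun n c => c • toMultilinear (g 0 (.ups n)) v := by
  rw [InsGen.eval_lin]
  let φ : MultilinearMap K (fun _ : Fin 0 => V) V →+ V := ⟨⟨fun p => p v, rfl⟩, fun _ _ => rfl⟩
  exact map_sum φ _ _

/-- The relations of `Ins` hold in an endomorphism operad if and only if the corresponding
operations satisfy the axioms of an `Ins`-algebra. -/
theorem endValue_relation_iff (μ : V →ₗ[K] V →ₗ[K] V) (υ : ℕ → V)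
    (I : {l : ℕ →₀ K // l ≠ 0} → V →ₗ[K] V) :
    (∀ n a b, InsGen.Relation K n a b → a.eval (endOperad K V) (endValue μ υ I) =
      b.eval (endOperad K V) (endValue μ υ I)) ↔ Axioms K μ υ I := by
  have mul_ (v : Fin 2 → V) : toMultilinear ((OpExpr.gen InsGen.mul).eval (endOperad K V)
    (endValue μ υ I)) v = μ (v 0) (v 1) := rfl
  have one_ (v : Fin 1 → V) : toMultilinear (OpExpr.one.eval (endOperad K V)
    (endValue μ υ I)) v = v 0 := rfl
  -- The arities `2 + 1`, `1 + 2`, `0 + 1` and `1 + 0` agree with `3` and `1` only by computation,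
  -- so the arities of the inner operations have to be given explicitly.
  have assoc_l (v : Fin 3 → V) : toMultilinear (OpExpr.eval (endOperad K V) (endValue μ υ I)
      (.comp₂ (.gen .mul) (.gen .mul) .one)) v = μ (μ (v 0) (v 1)) (v 2) := by
    refine (OpExpr.eval_comp₂_endOperad (m := 2) (n := 1) _ _ _ _ v).trans ?_
    rw [mul_]
    rfl
  have assoc_r (v : Fin 3 → V) : toMultilinear (OpExpr.eval (endOperad K V) (endValue μ υ I)
      (.comp₂ (.gen .mul) .one (.gen .mul))) v = μ (v 0) (μ (v 1) (v 2)) := by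
    refine (OpExpr.eval_comp₂_endOperad (m := 1) (n := 2) _ _ _ _ v).trans ?_
    rw [mul_]
    rfl
  have unit_l (v : Fin 1 → V) : toMultilinear (OpExpr.eval (endOperad K V) (endValue μ υ I)
      (.comp₂ (.gen .mul) (.gen (.ups 0)) .one)) v = μ (υ 0) (v 0) := by
    refine (OpExpr.eval_comp₂_endOperad (m := 0) (n := 1) _ _ _ _ v).trans ?_
    rw [mul_]
    rfl
  have unit_r (v : Fin 1 → V) : toMultilinear (OpExpr.eval (endOperad K V) (endValue μ υ I)
      (.comp₂ (.gen .mul) .one (.gen (.ups 0)))) v = μ (v 0) (υ 0) := by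
    refine (OpExpr.eval_comp₂_endOperad (m := 1) (n := 0) _ _ _ _ v).trans ?_
    rw [mul_]
    rfl
  have inv_l (l : {l : ℕ →₀ K // l ≠ 0}) (v : Fin 1 → V) :
      toMultilinear (OpExpr.eval (endOperad K V) (endValue μ υ I)
        (.comp₁ (.comp₂ (.gen .mul) (InsGen.lin K l.1) .one) (.gen (InsGen.inv l)))) v =
      μ (l.1.sum fun n c => c • υ n) (I l (v 0)) := by
    rw [OpExpr.eval_comp₁_endOperad]
    refine (OpExpr.eval_comp₂_endOperad (m := 0) (n := 1) _ _ _ _ _).trans ?_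
    rw [mul_]
    exact congrArg (fun a => μ a (I l (v 0))) (toMultilinear_eval_lin _ _ _)
  constructor
  · intro h
    refine ⟨fun x y z => ?_, fun x => ?_, fun x => ?_, fun l x => ?_⟩
    · exact (assoc_l ![x, y, z]).symm.trans
        ((congrArg (toMultilinear · ![x, y, z]) (h _ _ _ .assoc)).trans (assoc_r ![x, y, z]))
    · exact (unit_l ![x]).symm.trans
        ((congrArg (toMultilinear · ![x]) (h _ _ _ .unit_left)).trans (one_ ![x]))
    · exact (unit_r ![x]).symm.trans
        ((congrArg (toMultilinear · ![x]) (h _ _ _ .unit_right)).trans (one_ ![x]))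
    · exact (inv_l l ![x]).symm.trans
        ((congrArg (toMultilinear · ![x]) (h _ _ _ (.inv l))).trans (one_ ![x]))
  · rintro h _ _ _ (_ | _ | _ | l)
    · exact MultilinearMap.ext fun v => (assoc_l v).trans ((h.assoc _ _ _).trans (assoc_r v).symm)
    · exact MultilinearMap.ext fun v => (unit_l v).trans ((h.unit_left _).trans (one_ v).symm)
    · exact MultilinearMap.ext fun v => (unit_r v).trans ((h.unit_right _).trans (one_ v).symm)
    · exact MultilinearMap.ext fun v => (inv_l l v).trans ((h.inv _ _).trans (one_ v).symm)

/-- An algebra structure is given by `μ`, `υ` and `I` exactly when these are its values on the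
generators. -/
theorem isGivenBy_iff (α : AlgebraOn (Ins K) V) (μ : V →ₗ[K] V →ₗ[K] V) (υ : ℕ → V)
    (I : {l : ℕ →₀ K // l ≠ 0} → V →ₗ[K] V) :
    IsGivenBy K α μ υ I ↔
      (fun n (c : InsGen K n) => α.app n (PresObj.mk (.gen c))) = endValue μ υ I := by
  constructor
  · intro h
    funext n c
    cases c with
    | mul =>
      refine MultilinearMap.ext fun v => ?_
      rw [show v = ![v 0, v 1] from (List.ofFn_inj.mp rfl)]
      exact h.mul _ _
    | ups n =>
      refine MultilinearMap.ext fun v => ?_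
      rw [Subsingleton.elim v ![]]
      exact h.ups n
    | inv l =>
      refine MultilinearMap.ext fun v => ?_
      rw [show v = ![v 0] from (List.ofFn_inj.mp rfl)]
      exact h.inv l _
  · intro h
    refine ⟨fun x y => ?_, fun n => ?_, fun l x => ?_⟩
    · exact congrArg (toMultilinear · ![x, y]) (congrFun (congrFun h 2) .mul)
    · exact congrArg (toMultilinear · ![]) (congrFun (congrFun h 0) (.ups n))
    · exact congrArg (toMultilinear · ![x]) (congrFun (congrFun h 1) (.inv l))

theorem exists_isGivenBy (α : AlgebraOn (Ins K) V) :
    ∃ μ υ I, Axioms K μ υ I ∧ IsGivenBy K α μ υ I := by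
  let μ : V →ₗ[K] V →ₗ[K] V :=
    (MultilinearMap.ofSubsingletonₗ K K V V (0 : Fin 1)).symm.toLinearMap ∘ₗ
      (toMultilinear (α.app 2 (mul K))).curryLeft
  let υ : ℕ → V := fun n => toMultilinear (α.app 0 (ups K n)) ![]
  let I : {l : ℕ →₀ K // l ≠ 0} → V →ₗ[K] V := fun l =>
    (MultilinearMap.ofSubsingleton K V V (0 : Fin 1)).symm (toMultilinear (α.app 1 (inv K l)))
  have h : IsGivenBy K α μ υ I := by
    refine ⟨fun x y => ?_, fun n => rfl, fun l x => ?_⟩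
    · refine congrArg (toMultilinear (α.app 2 (mul K))) (List.ofFn_inj.mp rfl)
    · refine congrArg (toMultilinear (α.app 1 (inv K l))) (List.ofFn_inj.mp rfl)
  refine ⟨μ, υ, I, (endValue_relation_iff μ υ I).mp fun n a b hab => ?_, h⟩
  rw [← (isGivenBy_iff α μ υ I).mp h]
  exact α.eval_eq_of_rel hab

theorem existsUnique_isGivenBy {μ : V →ₗ[K] V →ₗ[K] V} {υ : ℕ → V}
    {I : {l : ℕ →₀ K // l ≠ 0} → V →ₗ[K] V} (h : Axioms K μ υ I) :
    ∃! α : AlgebraOn (Ins K) V, IsGivenBy K α μ υ I := by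
  refine ⟨presentedLift _ (endValue μ υ I) ((endValue_relation_iff μ υ I).mpr h),
    (isGivenBy_iff _ μ υ I).mpr rfl, fun β hβ => Hom.presented_ext fun n c => ?_⟩
  exact congrFun (congrFun ((isGivenBy_iff β μ υ I).mp hβ) n) c

end Ins

/-! ### Infinite field extensions -/

section FieldExtension

variable {K : Type u} [Field K] {L : Type v} [Field L] [Algebra K L]

open scoped Classical in
theorem exists_linearIndependent_nat_zero_eq_one (h : ¬ FiniteDimensional K L) :
    ∃ υ : ℕ → L, υ 0 = 1 ∧ LinearIndependent K υ := by
  have h1 : LinearIndepOn K id ({1} : Set L) := LinearIndepOn.singleton one_ne_zero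
  let b := Module.Basis.extend h1
  have hinf : Infinite (h1.extend (Set.subset_univ _)) := by
    by_contra hfin
    rw [not_infinite_iff_finite] at hfin
    exact h (Module.Finite.of_basis b)
  obtain ⟨e⟩ : Nonempty (ℕ ↪ h1.extend (Set.subset_univ _)) := ⟨Infinite.natEmbedding _⟩
  let i : h1.extend (Set.subset_univ _) := ⟨1, h1.subset_extend _ rfl⟩
  -- exchanging two basis vectors makes the sequence start with `1`
  refine ⟨fun n => b (Equiv.swap (e 0) i (e n)), ?_, ?_⟩
  · simp [b, i]
  · exact b.linearIndependent.comp _ ((Equiv.injective _).comp e.injective)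

theorem sum_smul_ne_zero {υ : ℕ → L} (hυ : LinearIndependent K υ) {l : ℕ →₀ K} (hl : l ≠ 0) :
    (l.sum fun n c => c • υ n) ≠ 0 :=
  fun h => hl (linearIndependent_iff.mp hυ l h)

theorem Ins.axioms_of_linearIndependent {υ : ℕ → L} (h0 : υ 0 = 1) (hυ : LinearIndependent K υ) :
    Ins.Axioms K (LinearMap.mul K L) υ
      (fun l => LinearMap.mulLeft K ((l.1.sum fun n c => c • υ n)⁻¹)) where
  assoc := mul_assoc
  unit_left x := by simp [h0]
  unit_right x := by simp [h0]
  inv l x := mul_inv_cancel_left₀ (sum_smul_ne_zero hυ l.2) x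

end FieldExtension

theorem Ins.not_isTrivial (K : Type u) [Field K] : ¬ (Ins K).IsTrivial := by
  intro h
  have hK : ¬ FiniteDimensional K (RatFunc K) := fun _ =>
    RatFunc.transcendental_X (Algebra.IsAlgebraic.isAlgebraic (R := K) RatFunc.X)
  obtain ⟨υ, h0, hυ⟩ := exists_linearIndependent_nat_zero_eq_one hK
  obtain ⟨α, -⟩ := Ins.existsUnique_isGivenBy (Ins.axioms_of_linearIndependent h0 hυ)
  have := h 1
  have h1 : (endOperad K (RatFunc K)).one = 0 := by
    rw [← α.map_one, Subsingleton.elim (Ins K).one 0, map_zero]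
  exact one_ne_zero (congrArg (fun p => toMultilinear p ![(1 : RatFunc K)]) h1)

/-! ### Coalgebras over `Ins` -/

namespace Ins

open PiTensorProduct

section

variable {K : Type u} [Field K]

/-- Every sequence of vectors of a finite-dimensional space satisfies a nontrivial linear
relation. -/
theorem exists_ne_zero_sum_smul_eq_zero {E : Type*} [AddCommGroup E] [Module K E]
    [FiniteDimensional K E] (e : ℕ → E) : ∃ l : ℕ →₀ K, l ≠ 0 ∧ (l.sum fun n c => c • e n) = 0 := by
  by_contra! h
  have he : LinearIndependent K e := linearIndependent_iff.mpr fun l hl => by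
    by_contra hl0
    exact h l hl0 hl
  exact (Module.Finite.finite_basis (Module.Basis.span he)).not_infinite inferInstance

variable {V : Type w} [AddCommGroup V] [Module K V]

instance finiteDimensional_pow_zero : FiniteDimensional K (Pow K V 0) :=
  Module.Finite.equiv (isEmptyEquiv (R := K) (s := fun _ : Fin 0 => V) (Fin 0)).symm

theorem exists_sum_tprod {n : ℕ} (t : Pow K V n) :
    ∃ (m : ℕ) (c : Fin m → K) (a : Fin m → Fin n → V), t = ∑ i, c i • tprod K (a i) := by
  have ht : t ∈ Submodule.span K (Set.range (tprod K (s := fun _ : Fin n => V))) := by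
    rw [span_tprod_eq_top]
    trivial
  obtain ⟨m, c, s, hs⟩ := Submodule.mem_span_set'.mp ht
  choose a ha using fun i => (s i).2
  exact ⟨m, c, a, by simp only [ha, hs]⟩

/-- A composite of cooperations kills `x` if the `j`-th inner one kills the `j`-th tensor factors
of the image of `x` under the outer one. -/
theorem coendComp_apply_eq_zero {n m : ℕ} {k : Fin n → ℕ} {f : V →ₗ[K] Pow K V n}
    {g : ∀ i, V →ₗ[K] Pow K V (k i)} {x : V} {c : Fin m → K} {a : Fin m → Fin n → V}
    (hf : f x = ∑ i, c i • tprod K (a i)) (j : Fin n) (hg : ∀ i, g j (a i j) = 0) :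
    coendComp K V k f g x = 0 := by
  have h (i : Fin m) : PiTensorProduct.map g (tprod K (a i)) = 0 := by
    rw [map_tprod]
    exact (PiTensorProduct.tprod K).map_coord_zero j (hg i)
  rw [coendComp_apply, LinearMap.comp_apply, LinearMap.comp_apply, hf, map_sum]
  simp only [map_smul, h, smul_zero, Finset.sum_const_zero, map_zero]

/-- Let `Δ` be the comultiplication. Given `x`, the values of `υ 0, υ 1, …` on the finitely many
left tensor factors of `Δ x` satisfy a nontrivial linear relation `l`. Then `∑ n, l n • υ n` contracts
`Δ x` to zero, whereas `I_l` recovers `x` from this contraction. -/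
theorem subsingleton_of_coalgebraOn (α : CoalgebraOn (Ins K) V) : Subsingleton V := by
  refine subsingleton_of_forall_eq 0 fun x => ?_
  let g : ∀ n, InsGen K n → V →ₗ[K] Pow K V n := fun n c => α.app n (PresObj.mk (.gen c))
  obtain ⟨m, c, a, hΔ⟩ := exists_sum_tprod (g 2 .mul x)
  obtain ⟨l, hl, hrel⟩ :=
    exists_ne_zero_sum_smul_eq_zero (K := K) fun n => fun i : Fin m => g 0 (.ups n) (a i 0)
  let ε : V →ₗ[K] Pow K V 0 := (InsGen.lin K l).eval (coendOperad K V) g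
  have hε (i : Fin m) : ε (a i 0) = 0 := by
    have h1 : ε = l.sum fun n c => c • g 0 (.ups n) := InsGen.eval_lin _ _ _
    have h2 := congrFun hrel i
    rw [h1, Finsupp.sum, LinearMap.sum_apply]
    rw [Finsupp.sum, Finset.sum_apply] at h2
    exact h2
  -- The inner operations of `μ ∘ ((∑ n, l n • υ n) ⊗ id)`, whose cooperation is the contraction `q`.
  let b : ∀ i, OpExpr K (InsGen K) (![0, 1] i) := fun i =>
    match i with | 0 => InsGen.lin K l | 1 => .one
  let q : V →ₗ[K] Pow K V 1 := OpExpr.eval (coendOperad K V) g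
    (.comp₂ (.gen .mul) (InsGen.lin K l) .one)
  have hq : q x = 0 := by
    have h1 : q = powPerm K V (finCongr (by simp)) ∘ₗ coendComp K V ![0, 1] (g 2 .mul)
        (fun i => (b i).eval (coendOperad K V) g) := by
      simp only [q, OpExpr.comp₂]
      rw [OpExpr.eval, OpExpr.eval]
      rfl
    exact (LinearMap.congr_fun h1 x).trans
      ((congrArg _ (coendComp_apply_eq_zero hΔ 0 hε)).trans (map_zero _))
  -- The last relation of `Ins`; composition in the coendomorphism operad applies `q` first.
  have h : powPerm K V (Block.unitLeft 1).symm ∘ₗ coendComp K V (fun _ : Fin 1 => 1) q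
      (fun _ => g 1 (.inv ⟨l, hl⟩)) = (coendOperad K V).one := by
    have h1 := α.eval_eq_of_rel (InsGen.Relation.inv ⟨l, hl⟩)
    rw [OpExpr.comp₁, OpExpr.eval, OpExpr.eval] at h1
    exact h1
  have hx := LinearMap.congr_fun h x
  rw [coendComp_apply, LinearMap.comp_apply, LinearMap.comp_apply, LinearMap.comp_apply, hq,
    map_zero, map_zero, map_zero] at hx
  exact (LinearEquiv.map_eq_zero_iff
    (subsingletonEquiv (R := K) (s := fun _ : Fin 1 => V) 0).symm).mp hx.symm

end

/-! ### Cofree coalgebras over `Ins` -/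

section

variable (K : Type u) [Field K]

variable {K} in
theorem linearMap_ext_of_subsingleton {V : Type v} {W : Type w} [AddCommGroup V] [Module K V]
    [AddCommGroup W] [Module K W] [Subsingleton V] (f g : V →ₗ[K] W) : f = g :=
  LinearMap.ext fun x => by rw [Subsingleton.elim x 0, map_zero, map_zero]

/-- The unique `P`-coalgebra structure on the zero vector space. -/
noncomputable def zeroCoalg (P : LinOperad.{u, v} K) : Coalg.{u, v, w} P where
  carrier := ModuleCat.of K PUnit
  str :=
    { app := fun _ => 0
      map_perm := fun _ _ => linearMap_ext_of_subsingleton _ _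
      map_one := linearMap_ext_of_subsingleton _ _
      map_comp := fun _ _ _ => linearMap_ext_of_subsingleton _ _ }

instance subsingleton_carrier (C : Coalg.{u, u, w} (Ins K)) : Subsingleton C.carrier :=
  subsingleton_of_coalgebraOn C.str

noncomputable instance uniqueCoalgHom (C D : Coalg.{u, u, w} (Ins K)) : Unique (C ⟶ D) where
  default := ⟨0, fun p x => by rw [Subsingleton.elim x 0]; simp only [map_zero]⟩
  uniq f := Coalg.Hom.ext (LinearMap.ext fun x => Subsingleton.elim _ _)

noncomputable instance uniqueForgetHom (C : Coalg.{u, u, w} (Ins K)) (V : ModuleCat.{w} K) :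
    Unique ((Coalg.forget (Ins K)).obj C ⟶ V) where
  default := 0
  uniq _ := ModuleCat.hom_ext (linearMap_ext_of_subsingleton (V := C.carrier) _ _)

/-- All coalgebras being zero, the constant functor at the zero coalgebra provides cofree
coalgebras. -/
noncomputable def cofreeAdjunction :
    Coalg.forget.{u, u, w} (Ins K) ⊣ (Functor.const _).obj (zeroCoalg K (Ins K)) :=
  Adjunction.mkOfHomEquiv
    { homEquiv := fun _ _ => Equiv.ofUnique _ _
      homEquiv_naturality_left_symm := fun _ _ => Subsingleton.elim _ _
      homEquiv_naturality_right := fun _ _ => Subsingleton.elim _ _ }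

theorem isZero_comp_forget (R : ModuleCat.{w} K ⥤ Coalg.{u, u, w} (Ins K)) :
    Limits.IsZero (R ⋙ Coalg.forget (Ins K)) :=
  Functor.isZero _ fun V => @ModuleCat.isZero_of_subsingleton K _ _
    (subsingleton_carrier K (R.obj V))

end

end Ins

theorem mainTheorem1 (K : Type u) [Field K] :
    -- the `Ins`-algebras are the unital associative algebras endowed with `υ n` and `I_l`
    (∀ (V : Type v) [AddCommGroup V] [Module K V],
      (∀ α : AlgebraOn (Ins K) V, ∃ μ υ I, Ins.Axioms K μ υ I ∧ Ins.IsGivenBy K α μ υ I) ∧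
      (∀ μ υ I, Ins.Axioms K μ υ I → ∃! α : AlgebraOn (Ins K) V, Ins.IsGivenBy K α μ υ I)) ∧
    -- an infinite-dimensional field extension is a (nonzero) `Ins`-algebra
    (∀ (L : Type v) [Field L] [Algebra K L], ¬ FiniteDimensional K L →
      (∃ υ : ℕ → L, υ 0 = 1 ∧ LinearIndependent K υ) ∧
      (∀ υ : ℕ → L, υ 0 = 1 → LinearIndependent K υ →
        (∀ l : ℕ →₀ K, l ≠ 0 → (l.sum fun n c => c • υ n) ≠ 0) ∧
        ∃! α : AlgebraOn (Ins K) L, Ins.IsGivenBy K α (LinearMap.mul K L) υ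
          (fun l => LinearMap.mulLeft K ((l.1.sum fun n c => c • υ n)⁻¹)))) ∧
    -- the operad `Ins` is not trivial
    ¬ (Ins K).IsTrivial ∧
    -- every `Ins`-coalgebra is zero
    (∀ (V : Type w) [AddCommGroup V] [Module K V], CoalgebraOn (Ins K) V → Subsingleton V) ∧
    -- cofree `Ins`-coalgebras exist, and the associated comonad is zero
    (Coalg.forget.{u, u, w} (Ins K)).IsLeftAdjoint ∧
    (∀ (R : ModuleCat.{w} K ⥤ Coalg.{u, u, w} (Ins K)) (adj : Coalg.forget (Ins K) ⊣ R),
      Limits.IsZero adj.toComonad.toFunctor) := by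
  refine ⟨fun V _ _ => ⟨Ins.exists_isGivenBy, fun _ _ _ => Ins.existsUnique_isGivenBy⟩,
    fun L _ _ hL => ⟨exists_linearIndependent_nat_zero_eq_one hL, fun υ h0 hυ =>
      ⟨fun l => sum_smul_ne_zero hυ,
        Ins.existsUnique_isGivenBy (Ins.axioms_of_linearIndependent h0 hυ)⟩⟩,
    Ins.not_isTrivial K, fun V _ _ => Ins.subsingleton_of_coalgebraOn,
    (Ins.cofreeAdjunction K).isLeftAdjoint, fun R _ => Ins.isZero_comp_forget K R⟩
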